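/- **Theorem 3.1.** Let $A$ be an $f$-algebra: a real Riesz space (vector lattice) with an associative bilinear multiplication, not necessarily unital, such that $a,b\ge 0$ implies $ab\ge 0$, and $a\wedge b=0$, $c\ge 0$ imply $(ca)\wedge b=(ac)\wedge b=0$. Let $A^{\sim}$ be its order dual, that is, the Riesz space of all order bounded linear functionals on $A$, and assume that $A^{\sim}$ separates the points of $A$. Let $(A^{\sim})^{\sim}_n$ be the space of all order continuous functionals in the order bidual $(A^{\sim})^{\sim}$. For $a\in A$, $f\in A^{\sim}$ and $G\in(A^{\sim})^{\sim}_n$ define $f\cdot a\in A^{\sim}$ and $G\cdot f\in A^{\sim}$ by $$(f\cdot a)(b)=f(ab)\quad(b\in A),\qquad (G\cdot f)(a)=G(f\cdot a)\quad(a\in A).$$ An orthomorphism of a Riesz space $L$ is an order bounded linear operator $\pi:L\to L$ such that $|x|\wedge|y|=0$ implies $|\pi(x)|\wedge|y|=0$. An order bounded linear operator $T:A^{\sim}\to A^{\sim}$ is called $f$-linear with respect to $(A^{\sim})^{\sim}_n$ if $T(G\cdot f)=G\cdot T(f)$ for all $G\in(A^{\sim})^{\sim}_n$ and $f\in A^{\sim}$.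 Then every orthomorphism $\pi$ of $A^{\sim}$ is $f$-linear with respect to $(A^{\sim})^{\sim}_n$; that is, $\pi$ is order bounded and $$\pi(G\cdot f)=G\cdot\pi(f)\qquad\text{for all } G\in(A^{\sim})^{\sim}_n \text{ and } f\in A^{\sim}.$$ -/

import Mathlib

open Filter Topology

universe u v

set_option linter.unusedSectionVars false

/-! ## Order bounded operators and orthomorphisms

A Riesz space (real vector lattice) is a type `E` with
`[AddCommGroup E] [Lattice E] [IsOrderedAddMonoid E] [Module ℝ E] [IsOrderedModule ℝ E]`. -/

section Operators

variable {E : Type u} [AddCommGroup E] [Lattice E] [IsOrderedAddMonoid E]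
  [Module ℝ E] [IsOrderedModule ℝ E]
variable {F : Type v} [AddCommGroup F] [Lattice F] [IsOrderedAddMonoid F]
  [Module ℝ F] [IsOrderedModule ℝ F]

/-- A linear operator between Riesz spaces is order bounded if it maps order intervals into
order intervals. -/
def IsOrderBoundedOp (T : E →ₗ[ℝ] F) : Prop :=
  ∀ a b : E, ∃ c d : F, ∀ x ∈ Set.Icc a b, T x ∈ Set.Icc c d

/-- Disjointness `x ⊥ y` of two elements of a Riesz space: `|x| ∧ |y| = 0`. -/
def RieszDisjoint (x y : E) : Prop := |x| ⊓ |y| = 0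

/-- An orthomorphism of a Riesz space: an order bounded linear operator `π` such that
`x ⊥ y` implies `π x ⊥ y`. -/
structure IsOrthomorphism (π : E →ₗ[ℝ] E) : Prop where
  orderBounded : IsOrderBoundedOp π
  disjoint : ∀ x y : E, RieszDisjoint x y → RieszDisjoint (π x) y

end Operators

/-! ## The order dual -/

section Dual

variable (E : Type u) [AddCommGroup E] [Lattice E] [IsOrderedAddMonoid E]
  [Module ℝ E] [IsOrderedModule ℝ E]

/-- The vector space of order bounded linear functionals on `E`. -/
def orderBoundedFunctionals : Submodule ℝ (E →ₗ[ℝ] ℝ) where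
  carrier := {f | IsOrderBoundedOp f}
  zero_mem' := fun _ _ => ⟨0, 0, fun _ _ => by simp⟩
  add_mem' := by
    intro f g hf hg a b
    obtain ⟨c, d, h⟩ := hf a b
    obtain ⟨c', d', h'⟩ := hg a b
    exact ⟨c + c', d + d', fun x hx =>
      ⟨add_le_add (h x hx).1 (h' x hx).1, add_le_add (h x hx).2 (h' x hx).2⟩⟩
  smul_mem' := by
    intro r f hf a b
    obtain ⟨c, d, h⟩ := hf a b
    rcases le_total 0 r with hr | hr
    · exact ⟨r * c, r * d, fun x hx =>
        ⟨mul_le_mul_of_nonneg_left (h x hx).1 hr, mul_le_mul_of_nonneg_left (h x hx).2 hr⟩⟩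
    · exact ⟨r * d, r * c, fun x hx =>
        ⟨mul_le_mul_of_nonpos_left (h x hx).2 hr, mul_le_mul_of_nonpos_left (h x hx).1 hr⟩⟩

/-- The order dual `E~` of a Riesz space: all order bounded linear functionals on `E`. -/
def RieszDual : Type u := orderBoundedFunctionals E

namespace RieszDual

instance : AddCommGroup (RieszDual E) := inferInstanceAs (AddCommGroup (orderBoundedFunctionals E))

instance : Module ℝ (RieszDual E) := inferInstanceAs (Module ℝ (orderBoundedFunctionals E))

variable {E}

/-- The linear functional underlying an element of the order dual. -/
def toLin (f : RieszDual E) : E →ₗ[ℝ] ℝ := f.1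

instance : CoeFun (RieszDual E) (fun _ => E → ℝ) := ⟨fun f => f.toLin⟩

/-- An order bounded linear functional as an element of the order dual. -/
def mk (f : E →ₗ[ℝ] ℝ) (hf : IsOrderBoundedOp f) : RieszDual E := ⟨f, hf⟩

theorem orderBounded (f : RieszDual E) : IsOrderBoundedOp f.toLin := f.2

@[simp] theorem mk_apply (f : E →ₗ[ℝ] ℝ) (hf : IsOrderBoundedOp f) (x : E) : mk f hf x = f x := rfl

@[simp] theorem zero_apply (x : E) : (0 : RieszDual E) x = 0 := rfl

@[simp] theorem add_apply (f g : RieszDual E) (x : E) : (f + g) x = f x + g x := rfl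

@[simp] theorem neg_apply (f : RieszDual E) (x : E) : (-f) x = -f x := rfl

@[simp] theorem sub_apply (f g : RieszDual E) (x : E) : (f - g) x = f x - g x := rfl

@[simp] theorem smul_apply (r : ℝ) (f : RieszDual E) (x : E) : (r • f) x = r * f x := rfl

theorem ext_fun {f g : RieszDual E} (h : ∀ x, f x = g x) : f = g :=
  Subtype.ext (LinearMap.ext h)

/-- The order of the order dual: `f ≤ g` iff `f x ≤ g x` for all `x ≥ 0`. -/
instance : PartialOrder (RieszDual E) where
  le f g := ∀ x : E, 0 ≤ x → f x ≤ g x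
  le_refl _ _ _ := le_rfl
  le_trans _ _ _ h h' x hx := (h x hx).trans (h' x hx)
  le_antisymm f g h h' := by
    apply ext_fun
    intro x
    have h1 := le_antisymm (h _ (posPart_nonneg x)) (h' _ (posPart_nonneg x))
    have h2 := le_antisymm (h _ (negPart_nonneg x)) (h' _ (negPart_nonneg x))
    have h3 : x = x⁺ - x⁻ := (posPart_sub_negPart x).symm
    rw [h3, map_sub, map_sub, h1, h2]

theorem le_def {f g : RieszDual E} : f ≤ g ↔ ∀ x : E, 0 ≤ x → f x ≤ g x := Iff.rfl

instance : IsOrderedAddMonoid (RieszDual E) where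
  add_le_add_left f g h k x hx := by
    simpa using h x hx

/-! The positive part of a functional, `f⁺(x) = sup {f y : 0 ≤ y ≤ x}` for `x ≥ 0`. -/

/-- `sup {f y : 0 ≤ y ≤ x}`. -/
noncomputable def supIcc (f : RieszDual E) (x : E) : ℝ := sSup (f.toLin '' Set.Icc 0 x)

theorem le_supIcc (f : RieszDual E) {x y : E} (hy : 0 ≤ y) (hyx : y ≤ x) : f y ≤ supIcc f x := by
  obtain ⟨c, d, h⟩ := f.orderBounded 0 x
  apply le_csSup
  · refine ⟨d, ?_⟩
    rintro _ ⟨z, hz, rfl⟩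
    exact (h z hz).2
  · exact ⟨y, ⟨hy, hyx⟩, rfl⟩

theorem supIcc_le (f : RieszDual E) {x : E} (hx : 0 ≤ x) {r : ℝ}
    (h : ∀ y, 0 ≤ y → y ≤ x → f y ≤ r) : supIcc f x ≤ r := by
  apply csSup_le
  · exact ⟨_, 0, ⟨le_rfl, hx⟩, rfl⟩
  · rintro _ ⟨z, hz, rfl⟩
    exact h z hz.1 hz.2

theorem supIcc_nonneg (f : RieszDual E) {x : E} (hx : 0 ≤ x) : 0 ≤ supIcc f x := by
  simpa using le_supIcc f le_rfl hx

theorem supIcc_add (f : RieszDual E) {x y : E} (hx : 0 ≤ x) (hy : 0 ≤ y) :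
    supIcc f (x + y) = supIcc f x + supIcc f y := by
  apply le_antisymm
  · apply supIcc_le f (add_nonneg hx hy)
    intro w hw hwxy
    have h1 : f (w ⊓ x) ≤ supIcc f x := le_supIcc f (le_inf hw hx) inf_le_right
    have h2 : f (w - w ⊓ x) ≤ supIcc f y := by
      apply le_supIcc f (sub_nonneg.2 inf_le_left)
      rw [sub_le_comm]
      apply le_inf
      · exact sub_le_self _ hy
      · exact sub_le_iff_le_add.2 hwxy
    rw [map_sub] at h2
    linarith
  · have h1 : supIcc f x ≤ supIcc f (x + y) - supIcc f y := by
      apply supIcc_le f hx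
      intro a ha hax
      have h2 : supIcc f y ≤ supIcc f (x + y) - f a := by
        apply supIcc_le f hy
        intro b hb hby
        have := le_supIcc f (add_nonneg ha hb) (add_le_add hax hby)
        rw [map_add] at this
        linarith
      linarith
    linarith

theorem supIcc_smul (f : RieszDual E) {r : ℝ} (hr : 0 ≤ r) {x : E} (hx : 0 ≤ x) :
    supIcc f (r • x) = r * supIcc f x := by
  have key : ∀ s : ℝ, 0 < s → ∀ y : E, 0 ≤ y → s * supIcc f y ≤ supIcc f (s • y) := by
    intro s hs y hy
    rw [mul_comm, ← le_div_iff₀ hs]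
    apply supIcc_le f hy
    intro z hz hzy
    rw [le_div_iff₀ hs, mul_comm]
    have := le_supIcc f (smul_nonneg hs.le hz) (smul_le_smul_of_nonneg_left hzy hs.le)
    simpa using this
  rcases hr.eq_or_lt with rfl | hr
  · rw [zero_smul, zero_mul]
    apply le_antisymm _ (supIcc_nonneg f le_rfl)
    apply supIcc_le f le_rfl
    intro y h1 h2
    rw [le_antisymm h2 h1, map_zero]
  · apply le_antisymm _ (key r hr x hx)
    have := key r⁻¹ (inv_pos.2 hr) (r • x) (smul_nonneg hr.le hx)
    rw [inv_smul_smul₀ hr.ne'] at this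
    rwa [inv_mul_le_iff₀ hr] at this

theorem supIcc_sub (f : RieszDual E) {a b c d : E} (ha : 0 ≤ a) (hb : 0 ≤ b) (hc : 0 ≤ c)
    (hd : 0 ≤ d) (h : a - b = c - d) : supIcc f a - supIcc f b = supIcc f c - supIcc f d := by
  have h1 : a + d = c + b := by
    rw [sub_eq_sub_iff_add_eq_add] at h
    exact h
  have h2 := supIcc_add f ha hd
  rw [h1, supIcc_add f hc hb] at h2
  linarith

/-- The positive part as a linear functional. -/
noncomputable def posLin (f : RieszDual E) : E →ₗ[ℝ] ℝ where
  toFun x := supIcc f x⁺ - supIcc f x⁻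
  map_add' x y := by
    have h := supIcc_sub f (posPart_nonneg (x + y)) (negPart_nonneg (x + y))
      (add_nonneg (posPart_nonneg x) (posPart_nonneg y))
      (add_nonneg (negPart_nonneg x) (negPart_nonneg y))
      (by rw [posPart_sub_negPart, add_sub_add_comm, posPart_sub_negPart, posPart_sub_negPart])
    rw [h, supIcc_add f (posPart_nonneg x) (posPart_nonneg y),
      supIcc_add f (negPart_nonneg x) (negPart_nonneg y)]
    ring
  map_smul' r x := by
    have hp := posPart_nonneg x
    have hn := negPart_nonneg x
    rcases le_total 0 r with hr | hr
    · have h := supIcc_sub f (posPart_nonneg (r • x)) (negPart_nonneg (r • x))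
        (smul_nonneg hr hp) (smul_nonneg hr hn)
        (by rw [posPart_sub_negPart, ← smul_sub, posPart_sub_negPart])
      rw [h, supIcc_smul f hr hp, supIcc_smul f hr hn]
      simp [mul_sub]
    · have hr' : 0 ≤ -r := neg_nonneg.2 hr
      have h := supIcc_sub f (posPart_nonneg (r • x)) (negPart_nonneg (r • x))
        (smul_nonneg hr' hn) (smul_nonneg hr' hp)
        (by
          rw [posPart_sub_negPart, ← smul_sub, neg_smul, ← smul_neg, neg_sub,
            posPart_sub_negPart])
      rw [h, supIcc_smul f hr' hp, supIcc_smul f hr' hn]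
      simp only [RingHom.id_apply, smul_eq_mul]
      ring

theorem posLin_apply (f : RieszDual E) {x : E} (hx : 0 ≤ x) : posLin f x = supIcc f x := by
  have h := supIcc_sub f (posPart_nonneg x) (negPart_nonneg x) hx le_rfl
    (by rw [posPart_sub_negPart, sub_zero])
  have h0 := supIcc_add f (le_refl (0 : E)) (le_refl (0 : E))
  rw [add_zero] at h0
  change supIcc f x⁺ - supIcc f x⁻ = _
  linarith

/-- A positive linear functional is order bounded. -/
theorem isOrderBoundedOp_of_nonneg (f : E →ₗ[ℝ] ℝ) (hf : ∀ x, 0 ≤ x → 0 ≤ f x) :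
    IsOrderBoundedOp f := by
  intro a b
  refine ⟨f a, f b, fun x hx => ⟨?_, ?_⟩⟩
  · have := hf _ (sub_nonneg.2 hx.1)
    rw [map_sub] at this
    linarith
  · have := hf _ (sub_nonneg.2 hx.2)
    rw [map_sub] at this
    linarith

/-- The positive part as an element of the order dual. -/
noncomputable def pos (f : RieszDual E) : RieszDual E :=
  mk (posLin f) (isOrderBoundedOp_of_nonneg _ fun x hx => by
    rw [posLin_apply f hx]
    exact supIcc_nonneg f hx)

theorem pos_apply (f : RieszDual E) {x : E} (hx : 0 ≤ x) : pos f x = supIcc f x :=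
  posLin_apply f hx

theorem le_pos (f : RieszDual E) : f ≤ pos f := fun x hx => by
  rw [pos_apply f hx]
  exact le_supIcc f hx le_rfl

theorem zero_le_pos (f : RieszDual E) : 0 ≤ pos f := fun x hx => by
  rw [pos_apply f hx]
  exact supIcc_nonneg f hx

theorem pos_le {f g : RieszDual E} (h : f ≤ g) (h0 : 0 ≤ g) : pos f ≤ g := fun x hx => by
  rw [pos_apply f hx]
  apply supIcc_le f hx
  intro y hy hyx
  have h1 := h0 _ (sub_nonneg.2 hyx)
  rw [zero_apply, map_sub] at h1
  have h2 := h y hy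
  linarith

/-- The lattice structure of the order dual; it is determined by the order. -/
noncomputable instance : Lattice (RieszDual E) where
  sup f g := g + pos (f - g)
  inf f g := f - pos (f - g)
  le_sup_left f g := sub_le_iff_le_add'.1 (le_pos (f - g))
  le_sup_right f g := le_add_of_nonneg_right (zero_le_pos (f - g))
  sup_le f g k hf hg := by
    have : pos (f - g) ≤ k - g := pos_le (sub_le_sub_right hf g) (sub_nonneg.2 hg)
    exact le_sub_iff_add_le'.1 this
  inf_le_left f g := sub_le_self _ (zero_le_pos (f - g))
  inf_le_right f g := sub_le_comm.1 (le_pos (f - g))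
  le_inf k f g hf hg := by
    have : pos (f - g) ≤ f - k := pos_le (sub_le_sub_left hg f) (sub_nonneg.2 hf)
    exact le_sub_comm.1 this

instance : IsOrderedModule ℝ (RieszDual E) where
  smul_le_smul_of_nonneg_left r hr f g h x hx := by
    simpa using mul_le_mul_of_nonneg_left (h x hx) hr
  smul_le_smul_of_nonneg_right f hf r s h x hx := by
    simpa using mul_le_mul_of_nonneg_right h (hf x hx)

end RieszDual

/-- Order continuity of a functional: `f (x i) → 0` for every net `x` that converges in order to
`0`, that is, for which there is a net `y` decreasing to `0` with `|x i| ≤ y i` for all `i`. -/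
def IsOrderContinuous {E : Type u} [AddCommGroup E] [Lattice E] [IsOrderedAddMonoid E]
    [Module ℝ E] [IsOrderedModule ℝ E] (f : RieszDual E) : Prop :=
  ∀ (ι : Type u) [Preorder ι] [IsDirectedOrder ι] [Nonempty ι] (x y : ι → E),
    Antitone y → IsGLB (Set.range y) 0 → (∀ i, |x i| ≤ y i) →
    Tendsto (fun i => f (x i)) atTop (𝓝 0)

/-- The order continuous part `E~_n` of the order dual. -/
def orderContinuousDual : Submodule ℝ (RieszDual E) where
  carrier := {f | IsOrderContinuous f}
  zero_mem' := fun _ _ _ _ _ _ _ _ _ => tendsto_const_nhds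
  add_mem' := by
    intro f g hf hg ι _ _ _ x y h1 h2 h3
    simpa using (hf ι x y h1 h2 h3).add (hg ι x y h1 h2 h3)
  smul_mem' := by
    intro r f hf ι _ _ _ x y h1 h2 h3
    simpa using (hf ι x y h1 h2 h3).const_mul r

/-- The order dual of `E` separates the points of `E`. -/
def HasSeparatingOrderDual : Prop := ∀ x : E, (∀ f : RieszDual E, f x = 0) → x = 0

end Dual

/-! ## f-algebras and the Arens products -/

section FAlgebra

/-- An f-algebra: a Riesz space with an associative bilinear multiplication (no unit and no
commutativity are required) such that products of positive elements are positive and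
`a ∧ b = 0`, `c ≥ 0` imply `(c * a) ∧ b = (a * c) ∧ b = 0`. -/
class IsFAlgebra (A : Type u) [NonUnitalRing A] [Lattice A] [IsOrderedAddMonoid A] [Module ℝ A]
    [IsOrderedModule ℝ A] [IsScalarTower ℝ A A] [SMulCommClass ℝ A A] : Prop where
  mul_nonneg : ∀ a b : A, 0 ≤ a → 0 ≤ b → 0 ≤ a * b
  mul_left_inf : ∀ a b c : A, a ⊓ b = 0 → 0 ≤ c → (c * a) ⊓ b = 0
  mul_right_inf : ∀ a b c : A, a ⊓ b = 0 → 0 ≤ c → (a * c) ⊓ b = 0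

variable {A : Type u} [NonUnitalRing A] [Lattice A] [IsOrderedAddMonoid A] [Module ℝ A]
  [IsOrderedModule ℝ A] [IsScalarTower ℝ A A] [SMulCommClass ℝ A A] [IsFAlgebra A]

theorem IsFAlgebra.mul_le_mul_left' {a b c : A} (h : a ≤ b) (hc : 0 ≤ c) : c * a ≤ c * b := by
  have := IsFAlgebra.mul_nonneg c (b - a) hc (sub_nonneg.2 h)
  rwa [mul_sub, sub_nonneg] at this

theorem IsFAlgebra.mul_le_mul_right' {a b c : A} (h : a ≤ b) (hc : 0 ≤ c) : a * c ≤ b * c := by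
  have := IsFAlgebra.mul_nonneg (b - a) c (sub_nonneg.2 h) hc
  rwa [sub_mul, sub_nonneg] at this

/-- The product `f · a` of `f ∈ A~` and `a ∈ A`: `(f · a) b = f (a * b)`. -/
def dualMul (f : RieszDual A) (a : A) : RieszDual A :=
  RieszDual.mk (f.toLin ∘ₗ LinearMap.mulLeft ℝ a) (by
    intro x y
    obtain ⟨c, d, h⟩ := f.orderBounded (a⁺ * x - a⁻ * y) (a⁺ * y - a⁻ * x)
    refine ⟨c, d, fun b hb => h _ ?_⟩
    have e : a * b = a⁺ * b - a⁻ * b := by rw [← sub_mul, posPart_sub_negPart]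
    rw [LinearMap.mulLeft_apply, e]
    exact ⟨sub_le_sub (IsFAlgebra.mul_le_mul_left' hb.1 (posPart_nonneg a))
        (IsFAlgebra.mul_le_mul_left' hb.2 (negPart_nonneg a)),
      sub_le_sub (IsFAlgebra.mul_le_mul_left' hb.2 (posPart_nonneg a))
        (IsFAlgebra.mul_le_mul_left' hb.1 (negPart_nonneg a))⟩)

@[simp] theorem dualMul_apply (f : RieszDual A) (a b : A) : dualMul f a b = f (a * b) := rfl

theorem dualMul_mono {f : RieszDual A} (hf : 0 ≤ f) {a b : A} (h : a ≤ b) :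
    dualMul f a ≤ dualMul f b := by
  intro x hx
  have := hf _ (sub_nonneg.2 (IsFAlgebra.mul_le_mul_right' h hx))
  rw [RieszDual.zero_apply, map_sub, sub_nonneg] at this
  simpa using this

/-- The product `F · f` of `F ∈ (A~)~` and `f ∈ A~`: `(F · f) a = F (f · a)`. -/
noncomputable def bidualMul (F : RieszDual (RieszDual A)) (f : RieszDual A) : RieszDual A :=
  RieszDual.mk
    { toFun := fun a => F (dualMul f a)
      map_add' := fun a b => by
        rw [← map_add]
        congr 1
        apply RieszDual.ext_fun
        intro x
        simp [add_mul]
      map_smul' := fun r a => by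
        rw [RingHom.id_apply, ← map_smul]
        congr 1
        apply RieszDual.ext_fun
        intro x
        simp [smul_mul_assoc] }
    (by
      intro x y
      obtain ⟨c, d, h⟩ := F.orderBounded (dualMul f⁺ x - dualMul f⁻ y) (dualMul f⁺ y - dualMul f⁻ x)
      refine ⟨c, d, fun a ha => h _ ?_⟩
      have e : dualMul f a = dualMul f⁺ a - dualMul f⁻ a := by
        apply RieszDual.ext_fun
        intro z
        rw [RieszDual.sub_apply, dualMul_apply, dualMul_apply, dualMul_apply,
          ← RieszDual.sub_apply, posPart_sub_negPart]
      rw [e]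
      exact ⟨sub_le_sub (dualMul_mono (posPart_nonneg f) ha.1)
          (dualMul_mono (negPart_nonneg f) ha.2),
        sub_le_sub (dualMul_mono (posPart_nonneg f) ha.2)
          (dualMul_mono (negPart_nonneg f) ha.1)⟩)

@[simp] theorem bidualMul_apply (F : RieszDual (RieszDual A)) (f : RieszDual A) (a : A) :
    bidualMul F f a = F (dualMul f a) := rfl

/-- An operator `T` on `A~` is f-linear with respect to `(A~)~_n` if it is linear, order bounded
and `T (G · f) = G · T f` for all `G ∈ (A~)~_n` and `f ∈ A~`. -/
structure IsFLinear (T : RieszDual A →ₗ[ℝ] RieszDual A) : Prop where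
  orderBounded : IsOrderBoundedOp T
  map_bidualMul : ∀ G ∈ orderContinuousDual (RieszDual A), ∀ f : RieszDual A,
    T (bidualMul G f) = bidualMul G (T f)

end FAlgebra

/-! ### Disjointness in lattice-ordered groups. -/

section LatticeGroup

variable {E : Type u} [AddCommGroup E] [Lattice E] [IsOrderedAddMonoid E]

/-! The theorem is an instance of commutativity: orthomorphisms of an Archimedean Riesz space
commute, `A~` is Archimedean, and for order continuous `G` the map `f ↦ G · f` is itself an
orthomorphism of `A~`.

Commutativity (`IsOrthomorphism.comp_eq_comp`) is proved without representation theory. A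
multiplication operator satisfies `(π y)⁺ ⊥ (π x)⁻` for `x, y ≥ 0`. This is obtained by slicing `y -
t x` along a grid of step `ε` and tracking disjoint pairs along the grid
(`le_sup_of_disjoint_chain`); the Archimedean property removes the errors. It makes an orthomorphism
a difference of positive ones, and, applied to `S - t`, it drives a second slicing argument showing
`S T x ≤ T S x` for positive `S`, `T`.

For the orthomorphism property of `f ↦ G · f`, let `f ∧ g = 0` and `b ≥ 0`. Riesz–Kantorovich gives
`0 ≤ x n ≤ b` with `f (x n)` and `g (b - x n)` summably small. It remains to make `|G · f| (x n)`
small, that is, `G (f · v n)` for suitable `|v n| ≤ x n`. The f-algebra inequality `k w c ≤ k² w + w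
c c` turns smallness of `f w` into smallness of `(f · w) c`, which yields a sequence decreasing to
`0` that dominates `|f · v n|`; order continuity of `G` concludes. -/

theorem inf_add_le_inf_add_inf {a b c : E} (ha : 0 ≤ a) (hb : 0 ≤ b) (hc : 0 ≤ c) :
    a ⊓ (b + c) ≤ a ⊓ b + a ⊓ c := by
  rw [add_inf, inf_add, inf_add]
  refine le_inf (le_inf ?_ ?_) (le_inf ?_ inf_le_right)
  · exact inf_le_left.trans (le_add_of_nonneg_left ha)
  · exact inf_le_left.trans (le_add_of_nonneg_left hb)
  · exact inf_le_left.trans (le_add_of_nonneg_right hc)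

theorem inf_eq_zero_of_le {a a' b b' : E} (h : a ⊓ b = 0) (ha' : 0 ≤ a') (hb' : 0 ≤ b')
    (haa' : a' ≤ a) (hbb' : b' ≤ b) : a' ⊓ b' = 0 :=
  le_antisymm ((inf_le_inf haa' hbb').trans h.le) (le_inf ha' hb')

theorem inf_add_eq_zero {a b c : E} (hb : a ⊓ b = 0) (hc : a ⊓ c = 0) : a ⊓ (b + c) = 0 := by
  have ha : 0 ≤ a := hb ▸ inf_le_left
  have hb0 : 0 ≤ b := hb ▸ inf_le_right
  have hc0 : 0 ≤ c := hc ▸ inf_le_right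
  refine le_antisymm ?_ (le_inf ha (add_nonneg hb0 hc0))
  simpa [hb, hc] using inf_add_le_inf_add_inf ha hb0 hc0

theorem posPart_sub_eq_of_inf_eq_zero {a b : E} (h : a ⊓ b = 0) : (a - b)⁺ = a := by
  have := inf_eq_sub_posPart_sub a b
  rw [h] at this
  exact (sub_eq_zero.1 this.symm).symm

/-- A discrete continuity argument. At each index `z` lies below `a i ⊔ b i`, and `z` starts on the
`a` side. Since `b` grows by at most `δ` per step, `a k ⊓ b (k + 1) ≤ δ`, so `z` can cross to the
`b` side only up to `δ`. -/
theorem le_sup_of_disjoint_chain {z δ : E} {a b : ℕ → E} (hδ : 0 ≤ δ)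
    (hz : ∀ i, z ≤ a i + b i) (hab : ∀ i, a i ⊓ b i = 0) (hb₀ : b 0 = 0)
    (hb : ∀ i, b (i + 1) ≤ b i + δ) (i : ℕ) : z ≤ δ ⊔ a i := by
  let : DistribLattice E := AddCommGroup.toDistribLattice E
  have ha0 (i) : 0 ≤ a i := hab i ▸ inf_le_left
  have hb0 (i) : 0 ≤ b i := hab i ▸ inf_le_right
  have hz' (i) : z ≤ a i ⊔ b i := by
    have h := inf_add_sup (a i) (b i)
    rw [hab, zero_add] at h
    exact h ▸ hz i
  induction i with
  | zero => simpa [hb₀] using (hz 0).trans le_sup_right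
  | succ k ih =>
    have h : a k ⊓ b (k + 1) ≤ δ := by
      calc a k ⊓ b (k + 1) ≤ a k ⊓ (b k + δ) := inf_le_inf_left _ (hb k)
        _ ≤ a k ⊓ b k + a k ⊓ δ := inf_add_le_inf_add_inf (ha0 k) (hb0 k) hδ
        _ ≤ δ := by rw [hab, zero_add]; exact inf_le_right
    refine (le_inf ih (hz' (k + 1))).trans ?_
    rw [inf_sup_right, inf_sup_left (a k)]
    exact sup_le (inf_le_left.trans le_sup_left)
      (sup_le (inf_le_right.trans le_sup_right) (h.trans le_sup_left))

end LatticeGroup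

/-! ### Scalars and the Archimedean property. -/

section Riesz

variable {E : Type u} [AddCommGroup E] [Lattice E] [IsOrderedAddMonoid E]
  [Module ℝ E] [IsOrderedModule ℝ E]

theorem posPart_smul_of_nonneg {r : ℝ} (hr : 0 ≤ r) (x : E) : (r • x)⁺ = r • x⁺ := by
  rcases hr.eq_or_lt with rfl | hr
  · simp
  apply le_antisymm
  · exact sup_le (smul_le_smul_of_nonneg_left (le_posPart x) hr.le)
      (smul_nonneg hr.le (posPart_nonneg x))
  · rw [← le_inv_smul_iff_of_pos hr]
    refine sup_le ?_ (smul_nonneg (inv_pos.2 hr).le (posPart_nonneg _))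
    rw [le_inv_smul_iff_of_pos hr]
    exact le_posPart _

theorem inf_smul_eq_zero {a b : E} (h : a ⊓ b = 0) {r : ℝ} (hr : 0 ≤ r) : a ⊓ r • b = 0 := by
  have ha : 0 ≤ a := h ▸ inf_le_left
  have hb : 0 ≤ b := h ▸ inf_le_right
  -- Dividing by `max r 1` brings `a` below `a` and `r • b` below `b` at once.
  have hr' : 0 < max r 1 := lt_max_of_lt_right one_pos
  refine le_antisymm ?_ (le_inf ha (smul_nonneg hr hb))
  have hle : (max r 1)⁻¹ • (a ⊓ r • b) ≤ a ⊓ b := by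
    refine le_inf ?_ ?_
    · rw [inv_smul_le_iff_of_pos hr']
      refine inf_le_left.trans ?_
      simpa using smul_le_smul_of_nonneg_right (le_max_right r 1) ha
    · rw [inv_smul_le_iff_of_pos hr']
      exact inf_le_right.trans (smul_le_smul_of_nonneg_right (le_max_left r 1) hb)
  rw [h, inv_smul_le_iff_of_pos hr', smul_zero] at hle
  exact hle

theorem abs_smul_le (r : ℝ) (x : E) : |r • x| ≤ |r| • |x| := by
  have key (s : ℝ) (hs : 0 ≤ s) : |s • x| ≤ s • |x| := by
    refine sup_le (smul_le_smul_of_nonneg_left (le_abs_self x) hs) ?_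
    rw [← smul_neg]
    exact smul_le_smul_of_nonneg_left (neg_le_abs x) hs
  rcases le_total 0 r with hr | hr
  · rw [abs_of_nonneg hr]
    exact key r hr
  · rw [abs_of_nonpos hr, ← abs_neg, ← neg_smul]
    exact key (-r) (neg_nonneg.2 hr)

/-- An Archimedean Riesz space: no nonzero positive element is infinitely small. -/
def IsArchimedeanRiesz (E : Type u) [AddCommGroup E] [Lattice E] [Module ℝ E] : Prop :=
  ∀ x y : E, (∀ ε : ℝ, 0 < ε → x ≤ ε • y) → x ≤ 0

/-- For `s ≥ ε⁻¹`, `x` exceeds `ε • (s • x - y)⁺` by at most `ε • y`, so only `ε • y` can meet `z`.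
-/
theorem IsArchimedeanRiesz.inf_eq_zero (hE : IsArchimedeanRiesz E) {x y z : E} (hx : 0 ≤ x)
    (hy : 0 ≤ y) (hz : 0 ≤ z) (h : ∀ t : ℝ, ∃ s, t ≤ s ∧ z ⊓ (s • x - y)⁺ = 0) :
    z ⊓ x = 0 := by
  refine le_antisymm (hE _ y fun ε hε => ?_) (le_inf hz hx)
  obtain ⟨s, hs, hzs⟩ := h ε⁻¹
  have hle : x - ε • y ≤ ε • (s • x - y)⁺ := by
    rw [← posPart_smul_of_nonneg hε.le]
    refine le_trans ?_ (le_posPart _)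
    rw [smul_sub, smul_smul]
    refine sub_le_sub_right ?_ _
    have : 1 ≤ ε * s := by
      have := mul_le_mul_of_nonneg_left hs hε.le
      rwa [mul_inv_cancel₀ hε.ne'] at this
    simpa using smul_le_smul_of_nonneg_right this hx
  have hy' : 0 ≤ ε • y := smul_nonneg hε.le hy
  calc z ⊓ x ≤ z ⊓ (ε • (s • x - y)⁺ + ε • y) := inf_le_inf_left _ (sub_le_iff_le_add.1 hle)
    _ ≤ z ⊓ ε • (s • x - y)⁺ + z ⊓ ε • y :=
      inf_add_le_inf_add_inf hz (smul_nonneg hε.le (posPart_nonneg _)) hy'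
    _ ≤ ε • y := by
      rw [inf_smul_eq_zero hzs hε.le, zero_add]
      exact inf_le_right

/-! ### Commutation of positive orthomorphisms. -/

namespace IsOrthomorphism

theorem abs_inf_eq_zero {π : E →ₗ[ℝ] E} (hπ : IsOrthomorphism π) {x y : E} (h : x ⊓ y = 0) :
    |π x| ⊓ y = 0 := by
  have hx : 0 ≤ x := h ▸ inf_le_left
  have hy : 0 ≤ y := h ▸ inf_le_right
  have := hπ.disjoint x y (by rwa [RieszDisjoint, abs_of_nonneg hx, abs_of_nonneg hy])
  rwa [RieszDisjoint, abs_of_nonneg hy] at this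

theorem abs_inf_abs_eq_zero {π : E →ₗ[ℝ] E} (hπ : IsOrthomorphism π) {x y : E} (h : x ⊓ y = 0) :
    |π x| ⊓ |π y| = 0 := by
  rw [inf_comm]
  apply hπ.abs_inf_eq_zero
  rw [inf_comm]
  exact hπ.abs_inf_eq_zero h

/-- The bound scales with `r`: a grid step of size `ε` along `x` moves the image by at most `ε • h`.
-/
theorem exists_abs_le {π : E →ₗ[ℝ] E} (hπ : IsOrthomorphism π) (x : E) :
    ∃ h : E, 0 ≤ h ∧ ∀ r : ℝ, 0 < r → ∀ y, 0 ≤ y → y ≤ r • x → |π y| ≤ r • h := by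
  obtain ⟨c, d, hcd⟩ := hπ.orderBounded 0 x
  refine ⟨|c| + |d|, add_nonneg (abs_nonneg c) (abs_nonneg d), fun r hr y hy hyx => ?_⟩
  have hm := hcd (r⁻¹ • y) ⟨smul_nonneg (inv_pos.2 hr).le hy, (inv_smul_le_iff_of_pos hr).2 hyx⟩
  rw [map_smul] at hm
  have h1 : π y ≤ r • d := (inv_smul_le_iff_of_pos hr).1 hm.2
  have h2 : r • c ≤ π y := (le_inv_smul_iff_of_pos hr).1 hm.1
  refine sup_le (h1.trans (smul_le_smul_of_nonneg_left ?_ hr.le)) ?_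
  · exact (le_abs_self d).trans (le_add_of_nonneg_left (abs_nonneg c))
  · refine (neg_le_neg h2).trans ?_
    rw [← smul_neg]
    exact smul_le_smul_of_nonneg_left
      ((neg_le_abs c).trans (le_add_of_nonneg_right (abs_nonneg d))) hr.le

/-- The sign of `π` at a "point" does not depend on the positive element it is tested on. The chain
lemma is applied to the images of the two parts of `y - t • x`, with `t` running through the
multiples of `ε`. -/
theorem posPart_map_inf_negPart_map_eq_zero (hE : IsArchimedeanRiesz E) {π : E →ₗ[ℝ] E}
    (hπ : IsOrthomorphism π) {x y : E} (hx : 0 ≤ x) (hy : 0 ≤ y) : (π y)⁺ ⊓ (π x)⁻ = 0 := by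
  obtain ⟨h, hh, hbd⟩ := hπ.exists_abs_le x
  set z := (π y)⁺ ⊓ (π x)⁻ with hz
  have hz0 : 0 ≤ z := le_inf (posPart_nonneg _) (negPart_nonneg _)
  refine le_antisymm (hE z h fun ε hε => ?_) hz0
  let t : ℕ → ℝ := fun i => i * ε
  have ht (i) : 0 ≤ t i := mul_nonneg i.cast_nonneg hε.le
  have hdisj (i) : |π (y - t i • x)⁺| ⊓ |π (y - t i • x)⁻| = 0 :=
    hπ.abs_inf_abs_eq_zero (posPart_inf_negPart_eq_zero _)
  have key (i : ℕ) : z ≤ ε • h ⊔ |π (y - t i • x)⁺| := by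
    refine le_sup_of_disjoint_chain (a := fun i => |π (y - t i • x)⁺|)
      (b := fun i => |π (y - t i • x)⁻|) (smul_nonneg hε.le hh) (fun i => ?_) hdisj ?_
      (fun i => ?_) i
    · have hs0 : 0 ≤ |π (y - t i • x)⁺| + |π (y - t i • x)⁻| :=
        add_nonneg (abs_nonneg _) (abs_nonneg _)
      have h1 : (π y)⁺ ≤ (|π (y - t i • x)⁺| + |π (y - t i • x)⁻|) + t i • (π x)⁺ := by
        refine sup_le ?_ (add_nonneg hs0 (smul_nonneg (ht i) (posPart_nonneg _)))
        have e : π y = (π (y - t i • x)⁺ + -π (y - t i • x)⁻) + t i • π x := by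
          rw [← sub_eq_add_neg, ← map_sub, posPart_sub_negPart, ← map_smul, ← map_add,
            sub_add_cancel]
        conv_lhs => rw [e]
        exact add_le_add (add_le_add (le_abs_self _) (neg_le_abs _))
          (smul_le_smul_of_nonneg_left (le_posPart _) (ht i))
      -- Since `z ≤ (π x)⁻`, the term `t i • (π x)⁺` contributes nothing to a bound for `z`.
      have h2 : z ⊓ t i • (π x)⁺ = 0 := by
        refine inf_smul_eq_zero ?_ (ht i)
        rw [inf_comm]
        exact inf_eq_zero_of_le (posPart_inf_negPart_eq_zero (π x)) (posPart_nonneg _) hz0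
          le_rfl inf_le_right
      have h3 : z ≤ z ⊓ ((|π (y - t i • x)⁺| + |π (y - t i • x)⁻|) + t i • (π x)⁺) :=
        le_inf le_rfl (inf_le_left.trans h1)
      refine h3.trans ((inf_add_le_inf_add_inf hz0 hs0
        (smul_nonneg (ht i) (posPart_nonneg _))).trans ?_)
      rw [h2, add_zero]
      exact inf_le_right
    · simp [t, negPart_eq_zero.2 hy]
    · have e : t (i + 1) • x = t i • x + ε • x := by
        simp only [t]
        rw [← add_smul]
        push_cast
        ring_nf
      have hεx : 0 ≤ ε • x := smul_nonneg hε.le hx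
      have h1 : (y - t i • x)⁻ ≤ (y - t (i + 1) • x)⁻ := by
        refine negPart_anti ?_
        rw [e]
        exact sub_le_sub_left (le_add_of_nonneg_right hεx) _
      have h2 : (y - t (i + 1) • x)⁻ ≤ (y - t i • x)⁻ + ε • x := by
        refine sup_le ?_ (add_nonneg (negPart_nonneg _) hεx)
        rw [e, ← sub_sub, neg_sub, sub_eq_add_neg, add_comm]
        exact add_le_add_left (neg_le_negPart _) _
      have h3 := hbd ε hε _ (sub_nonneg.2 h1) (sub_le_iff_le_add'.2 h2)
      rw [map_sub] at h3
      have := abs_add_le (π (y - t i • x)⁻) (π (y - t (i + 1) • x)⁻ - π (y - t i • x)⁻)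
      rw [add_sub_cancel] at this
      exact this.trans (add_le_add_right h3 _)
  -- The excess of `z` over `ε • h` lies below every `|π (y - t i • x)⁺|`, hence is disjoint from
  -- `(t i • x - y)⁺` for arbitrarily large `t i`. It is therefore disjoint from `x`, and so from `π
  -- x`, while lying below `|π x|`.
  have hw0 : 0 ≤ (z - ε • h)⁺ := posPart_nonneg _
  have hwz : (z - ε • h)⁺ ≤ z := sup_le (sub_le_self _ (smul_nonneg hε.le hh)) hz0
  have hw (i : ℕ) : (z - ε • h)⁺ ≤ |π (y - t i • x)⁺| := by
    refine sup_le (sub_le_iff_le_add'.2 ((key i).trans ?_)) (abs_nonneg _)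
    exact sup_le (le_add_of_nonneg_right (abs_nonneg _))
      (le_add_of_nonneg_left (smul_nonneg hε.le hh))
  have hwx : (z - ε • h)⁺ ⊓ x = 0 := by
    refine hE.inf_eq_zero hx hy hw0 fun r => ?_
    obtain ⟨n, hn⟩ := exists_nat_ge (r / ε)
    refine ⟨t n, (div_le_iff₀ hε).1 hn, ?_⟩
    rw [← neg_sub y, posPart_neg]
    exact inf_eq_zero_of_le (hπ.abs_inf_eq_zero (posPart_inf_negPart_eq_zero _)) hw0
      (negPart_nonneg _) (hw n) le_rfl
  have hw' : |π x| ⊓ (z - ε • h)⁺ = 0 := hπ.abs_inf_eq_zero (by rwa [inf_comm])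
  have hle : (z - ε • h)⁺ ≤ |π x| := hwz.trans (inf_le_right.trans (sup_le (neg_le_abs _) (abs_nonneg _)))
  rw [inf_eq_right.2 hle] at hw'
  exact sub_nonpos.1 (posPart_eq_zero.1 hw')

theorem sub_smul_id {π : E →ₗ[ℝ] E} (hπ : IsOrthomorphism π) (hpos : ∀ x, 0 ≤ x → 0 ≤ π x)
    (r : ℝ) : IsOrthomorphism (π - r • LinearMap.id) where
  orderBounded a b := by
    have hmono {x y : E} (hxy : x ≤ y) : π x ≤ π y := by
      have := hpos _ (sub_nonneg.2 hxy)
      rwa [map_sub, sub_nonneg] at this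
    rcases le_total 0 r with hr | hr
    · exact ⟨π a - r • b, π b - r • a, fun x hx =>
        ⟨sub_le_sub (hmono hx.1) (smul_le_smul_of_nonneg_left hx.2 hr),
          sub_le_sub (hmono hx.2) (smul_le_smul_of_nonneg_left hx.1 hr)⟩⟩
    · exact ⟨π a - r • a, π b - r • b, fun x hx =>
        ⟨sub_le_sub (hmono hx.1) (smul_le_smul_of_nonpos_left hx.1 hr),
          sub_le_sub (hmono hx.2) (smul_le_smul_of_nonpos_left hx.2 hr)⟩⟩
  disjoint x y hxy := by
    have h1 : |y| ⊓ |π x| = 0 := by rw [inf_comm]; exact hπ.disjoint x y hxy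
    have h2 : |y| ⊓ |r| • |x| = 0 := inf_smul_eq_zero (by rw [inf_comm]; exact hxy) (abs_nonneg r)
    unfold RieszDisjoint
    rw [inf_comm]
    refine inf_eq_zero_of_le (inf_add_eq_zero h1 h2) (abs_nonneg _) (abs_nonneg _) le_rfl ?_
    rw [LinearMap.sub_apply, sub_eq_add_neg]
    refine (abs_add_le _ _).trans (add_le_add le_rfl ?_)
    rw [abs_neg]
    exact abs_smul_le r x

/-- For every `t`, the difference `S (T x) - T (S x)` equals `(S - t) (T x) - T ((S - t) x)`. Its
bounds `((S - t) (T x))⁺` and `T ((S - t) x)⁻` are disjoint, so the chain lemma applies again with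
`t` on a grid of step `ε`. -/
theorem comp_le_comp_of_pos (hE : IsArchimedeanRiesz E) {S T : E →ₗ[ℝ] E}
    (hS : IsOrthomorphism S) (hT : IsOrthomorphism T) (hS₀ : ∀ x, 0 ≤ x → 0 ≤ S x)
    (hT₀ : ∀ x, 0 ≤ x → 0 ≤ T x) {x : E} (hx : 0 ≤ x) : S (T x) ≤ T (S x) := by
  set y := T x with hy
  have hy₀ : 0 ≤ y := hT₀ x hx
  rw [← sub_nonpos]
  refine hE _ y fun ε hε => ?_
  set d := S y - T (S x) with hd
  let t : ℕ → ℝ := fun i => i * ε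
  have ht (i) : 0 ≤ t i := mul_nonneg i.cast_nonneg hε.le
  have hεy : 0 ≤ ε • y := smul_nonneg hε.le hy₀
  have hTmono {u v : E} (h : u ≤ v) : T u ≤ T v := by
    have := hT₀ _ (sub_nonneg.2 h)
    rwa [map_sub, sub_nonneg] at this
  have key (i : ℕ) : d ≤ ε • y ⊔ (S y - t i • y)⁺ := by
    refine le_sup_of_disjoint_chain (a := fun i => (S y - t i • y)⁺)
      (b := fun i => T (S x - t i • x)⁻) hεy (fun i => ?_) (fun i => ?_) ?_ (fun i => ?_) i
    · have e : d = (S y - t i • y) + -T (S x - t i • x) := by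
        rw [map_sub, map_smul, ← hy, hd]
        abel
      rw [e, ← map_neg]
      exact add_le_add (le_posPart _) (hTmono (neg_le_negPart _))
    · have h := posPart_map_inf_negPart_map_eq_zero hE (hS.sub_smul_id hS₀ (t i)) hx hy₀
      simp only [LinearMap.sub_apply, LinearMap.smul_apply, LinearMap.id_apply] at h
      have h' := hT.abs_inf_eq_zero ((inf_comm _ _).trans h)
      rwa [abs_of_nonneg (hT₀ _ (negPart_nonneg _)), inf_comm] at h'
    · simp [t, negPart_eq_zero.2 (hS₀ x hx)]
    · have e : t (i + 1) • x = t i • x + ε • x := by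
        simp only [t]
        rw [← add_smul]
        push_cast
        ring_nf
      rw [hy, ← map_smul, ← map_add]
      refine hTmono (sup_le ?_ (add_nonneg (negPart_nonneg _) (smul_nonneg hε.le hx)))
      rw [e, ← sub_sub, neg_sub, sub_eq_add_neg, add_comm]
      exact add_le_add_left (neg_le_negPart _) _
  have hw₀ : 0 ≤ (d - ε • y)⁺ := posPart_nonneg _
  have hw (i : ℕ) : (d - ε • y)⁺ ≤ (S y - t i • y)⁺ := by
    refine sup_le (sub_le_iff_le_add'.2 ((key i).trans ?_)) (posPart_nonneg _)
    exact sup_le (le_add_of_nonneg_right (posPart_nonneg _)) (le_add_of_nonneg_left hεy)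
  have hwy : (d - ε • y)⁺ ⊓ y = 0 := by
    refine hE.inf_eq_zero hy₀ (hS₀ y hy₀) hw₀ fun r => ?_
    obtain ⟨n, hn⟩ := exists_nat_ge (r / ε)
    refine ⟨t n, (div_le_iff₀ hε).1 hn, ?_⟩
    rw [← neg_sub (S y), posPart_neg]
    exact inf_eq_zero_of_le (posPart_inf_negPart_eq_zero _) hw₀ (negPart_nonneg _) (hw n) le_rfl
  have hw' := hS.abs_inf_eq_zero ((inf_comm _ _).trans hwy)
  have hle : (d - ε • y)⁺ ≤ |S y| := by
    refine (hw 0).trans ?_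
    simp only [t, Nat.cast_zero, zero_mul, zero_smul, sub_zero]
    exact sup_le (le_abs_self _) (abs_nonneg _)
  rw [inf_eq_right.2 hle] at hw'
  exact sub_nonpos.1 (posPart_eq_zero.1 hw')

theorem comp_eq_comp_of_pos (hE : IsArchimedeanRiesz E) {S T : E →ₗ[ℝ] E}
    (hS : IsOrthomorphism S) (hT : IsOrthomorphism T) (hS₀ : ∀ x, 0 ≤ x → 0 ≤ S x)
    (hT₀ : ∀ x, 0 ≤ x → 0 ≤ T x) (x : E) : S (T x) = T (S x) := by
  have key {z : E} (hz : 0 ≤ z) : S (T z) = T (S z) :=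
    le_antisymm (comp_le_comp_of_pos hE hS hT hS₀ hT₀ hz) (comp_le_comp_of_pos hE hT hS hT₀ hS₀ hz)
  rw [← posPart_sub_negPart x]
  simp only [map_sub, key (posPart_nonneg x), key (negPart_nonneg x)]

end IsOrthomorphism

/-- The linear extension of an additive and positively homogeneous map on the positive cone. -/
def LinearMap.ofPosCone (φ : E → E) (hadd : ∀ x y, 0 ≤ x → 0 ≤ y → φ (x + y) = φ x + φ y)
    (hsmul : ∀ (r : ℝ) (x), 0 ≤ r → 0 ≤ x → φ (r • x) = r • φ x) : E →ₗ[ℝ] E :=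
  have hsub {a b c d : E} (ha : 0 ≤ a) (hb : 0 ≤ b) (hc : 0 ≤ c) (hd : 0 ≤ d)
      (h : a - b = c - d) : φ a - φ b = φ c - φ d := by
    rw [sub_eq_sub_iff_add_eq_add] at h ⊢
    rw [← hadd a d ha hd, h, hadd c b hc hb]
  { toFun := fun x => φ x⁺ - φ x⁻
    map_add' := fun x y => by
      have hx := posPart_nonneg x
      have hx' := negPart_nonneg x
      have hy := posPart_nonneg y
      have hy' := negPart_nonneg y
      rw [hsub (posPart_nonneg (x + y)) (negPart_nonneg (x + y)) (add_nonneg hx hy)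
        (add_nonneg hx' hy')
        (by rw [posPart_sub_negPart, add_sub_add_comm, posPart_sub_negPart, posPart_sub_negPart]),
        hadd _ _ hx hy, hadd _ _ hx' hy']
      abel
    map_smul' := fun r x => by
      have hx := posPart_nonneg x
      have hx' := negPart_nonneg x
      rw [RingHom.id_apply]
      rcases le_total 0 r with hr | hr
      · rw [hsub (posPart_nonneg (r • x)) (negPart_nonneg (r • x)) (smul_nonneg hr hx)
          (smul_nonneg hr hx') (by rw [posPart_sub_negPart, ← smul_sub, posPart_sub_negPart]),
          hsmul _ _ hr hx, hsmul _ _ hr hx', smul_sub]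
      · have hr' : 0 ≤ -r := neg_nonneg.2 hr
        rw [hsub (posPart_nonneg (r • x)) (negPart_nonneg (r • x)) (smul_nonneg hr' hx')
          (smul_nonneg hr' hx)
          (by rw [posPart_sub_negPart, ← smul_sub, neg_smul, ← smul_neg, neg_sub,
            posPart_sub_negPart]),
          hsmul _ _ hr' hx, hsmul _ _ hr' hx', ← smul_sub, neg_smul, ← smul_neg, neg_sub] }

theorem LinearMap.ofPosCone_apply {φ : E → E}
    (hadd : ∀ x y, 0 ≤ x → 0 ≤ y → φ (x + y) = φ x + φ y)
    (hsmul : ∀ (r : ℝ) (x), 0 ≤ r → 0 ≤ x → φ (r • x) = r • φ x) {x : E} (hx : 0 ≤ x) :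
    LinearMap.ofPosCone φ hadd hsmul x = φ x := by
  have h₀ : φ 0 = 0 := by simpa using hsmul 0 0 le_rfl le_rfl
  change φ x⁺ - φ x⁻ = φ x
  rw [posPart_eq_self.2 hx, negPart_eq_zero.2 hx, h₀, sub_zero]

/-! ### Decomposition into positive orthomorphisms. -/

namespace IsOrthomorphism

theorem of_pos {π : E →ₗ[ℝ] E} (hpos : ∀ x, 0 ≤ x → 0 ≤ π x)
    (hdisj : ∀ x y, x ⊓ y = 0 → π x ⊓ y = 0) : IsOrthomorphism π where
  orderBounded a b := by
    have hmono {x y : E} (hxy : x ≤ y) : π x ≤ π y := by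
      have := hpos _ (sub_nonneg.2 hxy)
      rwa [map_sub, sub_nonneg] at this
    exact ⟨π a, π b, fun x hx => ⟨hmono hx.1, hmono hx.2⟩⟩
  disjoint x y hxy := by
    refine inf_eq_zero_of_le (hdisj _ _ hxy) (abs_nonneg _) (abs_nonneg _) ?_ le_rfl
    have h1 := hpos _ (sub_nonneg.2 (le_abs_self x))
    have h2 := hpos _ (sub_nonneg.2 (neg_le_abs x))
    rw [map_sub, sub_nonneg] at h1 h2
    rw [map_neg] at h2
    exact sup_le h1 h2

/-- An orthomorphism of an Archimedean Riesz space is a difference of positive ones. -/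
theorem exists_pos_sub_pos (hE : IsArchimedeanRiesz E) {π : E →ₗ[ℝ] E} (hπ : IsOrthomorphism π) :
    ∃ P N : E →ₗ[ℝ] E, IsOrthomorphism P ∧ IsOrthomorphism N ∧ (∀ x, 0 ≤ x → 0 ≤ P x) ∧
      (∀ x, 0 ≤ x → 0 ≤ N x) ∧ π = P - N := by
  have hadd (x y : E) (hx : 0 ≤ x) (hy : 0 ≤ y) : (π (x + y))⁺ = (π x)⁺ + (π y)⁺ := by
    have e : π (x + y) = ((π x)⁺ + (π y)⁺) - ((π x)⁻ + (π y)⁻) := by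
      rw [add_sub_add_comm, posPart_sub_negPart, posPart_sub_negPart, map_add]
    rw [e]
    apply posPart_sub_eq_of_inf_eq_zero
    -- All cross terms are disjoint, so `e` is the decomposition of `π (x + y)` into its positive
    -- and negative parts.
    have hd {a b : E} (ha : 0 ≤ a) (hb : 0 ≤ b) : (π a)⁺ ⊓ (π b)⁻ = 0 :=
      posPart_map_inf_negPart_map_eq_zero hE hπ hb ha
    rw [inf_comm]
    apply inf_add_eq_zero <;> rw [inf_comm] <;> apply inf_add_eq_zero <;>
      apply hd <;> assumption
  have hsmul (r : ℝ) (x : E) (hr : 0 ≤ r) (_ : 0 ≤ x) : (π (r • x))⁺ = r • (π x)⁺ := by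
    rw [map_smul, posPart_smul_of_nonneg hr]
  set P : E →ₗ[ℝ] E := LinearMap.ofPosCone (fun x => (π x)⁺) hadd hsmul
  have hP {x : E} (hx : 0 ≤ x) : P x = (π x)⁺ := LinearMap.ofPosCone_apply hadd hsmul hx
  have hN {x : E} (hx : 0 ≤ x) : (P - π) x = (π x)⁻ := by
    rw [LinearMap.sub_apply, hP hx, sub_eq_iff_eq_add', ← sub_eq_iff_eq_add, posPart_sub_negPart]
  refine ⟨P, P - π, of_pos (fun x hx => ?_) (fun x y h => ?_),
    of_pos (fun x hx => ?_) (fun x y h => ?_), fun x hx => ?_, fun x hx => ?_,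
    (sub_sub_cancel P π).symm⟩
  · exact hP hx ▸ posPart_nonneg _
  · have hx : 0 ≤ x := h ▸ inf_le_left
    rw [hP hx]
    exact inf_eq_zero_of_le (hπ.abs_inf_eq_zero h) (posPart_nonneg _) (h ▸ inf_le_right)
      (sup_le (le_abs_self _) (abs_nonneg _)) le_rfl
  · exact hN hx ▸ negPart_nonneg _
  · have hx : 0 ≤ x := h ▸ inf_le_left
    rw [hN hx]
    exact inf_eq_zero_of_le (hπ.abs_inf_eq_zero h) (negPart_nonneg _) (h ▸ inf_le_right)
      (sup_le (neg_le_abs _) (abs_nonneg _)) le_rfl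
  · exact hP hx ▸ posPart_nonneg _
  · exact hN hx ▸ negPart_nonneg _

/-- Orthomorphisms of an Archimedean Riesz space commute. -/
theorem comp_eq_comp (hE : IsArchimedeanRiesz E) {S T : E →ₗ[ℝ] E} (hS : IsOrthomorphism S)
    (hT : IsOrthomorphism T) (x : E) : S (T x) = T (S x) := by
  obtain ⟨P, N, hP, hN, hP₀, hN₀, rfl⟩ := hS.exists_pos_sub_pos hE
  obtain ⟨P', N', hP', hN', hP'₀, hN'₀, rfl⟩ := hT.exists_pos_sub_pos hE
  simp only [LinearMap.sub_apply, map_sub]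
  rw [comp_eq_comp_of_pos hE hP hP' hP₀ hP'₀, comp_eq_comp_of_pos hE hP hN' hP₀ hN'₀,
    comp_eq_comp_of_pos hE hN hP' hN₀ hP'₀, comp_eq_comp_of_pos hE hN hN' hN₀ hN'₀]
  abel

end IsOrthomorphism
end Riesz

/-! ### Riesz–Kantorovich formulas and monotone limits in the order dual. -/

namespace RieszDual

variable {E : Type u} [AddCommGroup E] [Lattice E] [IsOrderedAddMonoid E]
  [Module ℝ E] [IsOrderedModule ℝ E]

theorem isArchimedeanRiesz : IsArchimedeanRiesz (RieszDual E) := fun f g h x hx => by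
  have hlim : Tendsto (fun ε : ℝ => ε * g x) (𝓝[>] 0) (𝓝 0) := by
    have : Tendsto (fun ε : ℝ => ε * g x) (𝓝 0) (𝓝 (0 * g x)) := tendsto_id.mul_const _
    rw [zero_mul] at this
    exact this.mono_left nhdsWithin_le_nhds
  refine ge_of_tendsto hlim ?_
  filter_upwards [self_mem_nhdsWithin] with ε hε
  exact h ε hε x hx

theorem apply_mono {f : RieszDual E} (hf : 0 ≤ f) {x y : E} (h : x ≤ y) : f x ≤ f y := by
  have := hf _ (sub_nonneg.2 h)
  rwa [zero_apply, map_sub, sub_nonneg] at this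

theorem sup_apply (f g : RieszDual E) {x : E} (hx : 0 ≤ x) :
    (f ⊔ g) x = g x + supIcc (f - g) x := by
  rw [← pos_apply _ hx]
  rfl

theorem inf_apply (f g : RieszDual E) {x : E} (hx : 0 ≤ x) :
    (f ⊓ g) x = f x - supIcc (f - g) x := by
  rw [← pos_apply _ hx]
  rfl

theorem exists_lt_of_inf_eq_zero {f g : RieszDual E} (h : f ⊓ g = 0) {b : E} (hb : 0 ≤ b)
    {ε : ℝ} (hε : 0 < ε) : ∃ x, 0 ≤ x ∧ x ≤ b ∧ f x + g (b - x) < ε := by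
  by_contra! hcon
  have h0 := inf_apply f g hb
  rw [h, zero_apply] at h0
  have hle : supIcc (f - g) b ≤ f b - ε := by
    refine supIcc_le _ hb fun y hy hyb => ?_
    have := hcon (b - y) (sub_nonneg.2 hyb) (sub_le_self _ hy)
    rw [sub_sub_cancel, map_sub] at this
    rw [sub_apply]
    linarith
  linarith

theorem exists_abs_le_and_abs_apply_lt (f : RieszDual E) {x : E} (hx : 0 ≤ x) {ε : ℝ}
    (hε : 0 < ε) : ∃ y, |y| ≤ x ∧ |f| x < f y + ε := by
  by_contra! hcon
  have h0 : |f| x = (-f) x + supIcc (f - -f) x := sup_apply f (-f) hx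
  have hle : supIcc (f - -f) x ≤ |f| x - ε + f x := by
    refine supIcc_le _ hx fun y hy hyx => ?_
    -- The map `y ↦ 2 y - x` carries `[0, x]` into `[-x, x]`, matching `|f| = -f + (2 f)⁺`.
    have := hcon (y + y - x) (sup_le ?_ ?_)
    · rw [map_sub, map_add] at this
      rw [sub_apply, neg_apply]
      linarith
    · rw [sub_le_iff_le_add]
      exact add_le_add hyx hyx
    · rw [neg_sub]
      exact sub_le_self _ (add_nonneg hy hy)
  rw [neg_apply] at h0
  linarith

/-- An increasing sequence of functionals that is bounded above converges pointwise. -/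
theorem exists_tendsto_of_monotone {F : ℕ → RieszDual E} (hF : Monotone F) {g : RieszDual E}
    (hg : ∀ n, F n ≤ g) : ∃ s : RieszDual E, ∀ x, Tendsto (fun n => F n x) atTop (𝓝 (s x)) := by
  have hpos (x : E) (hx : 0 ≤ x) : ∃ l, Tendsto (fun n => F n x) atTop (𝓝 l) :=
    ⟨_, tendsto_atTop_ciSup (fun _ _ hmn => hF hmn x hx)
      ⟨g x, by rintro _ ⟨n, rfl⟩; exact hg n x hx⟩⟩
  have hall (x : E) : ∃ l, Tendsto (fun n => F n x) atTop (𝓝 l) := by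
    obtain ⟨p, hp⟩ := hpos _ (posPart_nonneg x)
    obtain ⟨q, hq⟩ := hpos _ (negPart_nonneg x)
    refine ⟨p - q, (hp.sub hq).congr fun n => ?_⟩
    rw [← map_sub, posPart_sub_negPart]
  choose l hl using hall
  let s : E →ₗ[ℝ] ℝ := linearMapOfTendsto l (fun n => (F n).toLin) (tendsto_pi_nhds.2 hl)
  -- Subtracting `F 0` makes the limit positive, hence order bounded.
  have hs : IsOrderBoundedOp (s - (F 0).toLin) := isOrderBoundedOp_of_nonneg _ fun x hx =>
    sub_nonneg.2 (ge_of_tendsto' (hl x) fun n => hF (Nat.zero_le n) x hx)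
  refine ⟨mk (s - (F 0).toLin) hs + F 0, fun x => ?_⟩
  rw [add_apply, mk_apply, LinearMap.sub_apply, sub_add_cancel]
  exact hl x

end RieszDual

/-! ### An f-algebra inequality. -/

namespace IsFAlgebra

variable {A : Type u} [NonUnitalRing A] [Lattice A] [IsOrderedAddMonoid A] [Module ℝ A]
  [IsOrderedModule ℝ A] [IsScalarTower ℝ A A] [SMulCommClass ℝ A A] [IsFAlgebra A]

/-- Split `w c - k w = p - n`. Multiplying by `c` gives `k w c ≤ w c c + n c`. Since `n c` is
disjoint from `p` and at most `k² w + k p`, it is at most `k² w`. No commutativity is needed. -/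
theorem smul_mul_le {w c : A} (hw : 0 ≤ w) (hc : 0 ≤ c) {k : ℝ} (hk : 0 ≤ k) :
    k • (w * c) ≤ k ^ 2 • w + w * c * c := by
  have hkw : 0 ≤ k • w := smul_nonneg hk hw
  set p := (w * c - k • w)⁺ with hp
  set n := (w * c - k • w)⁻ with hn
  have hp0 : 0 ≤ p := posPart_nonneg _
  have hn0 : 0 ≤ n := negPart_nonneg _
  have hpn : p - n = w * c - k • w := posPart_sub_negPart _
  have hnle : n ≤ k • w := by
    refine sup_le ?_ hkw
    rw [neg_sub]
    exact sub_le_self _ (IsFAlgebra.mul_nonneg _ _ hw hc)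
  have hnc0 : 0 ≤ n * c := IsFAlgebra.mul_nonneg _ _ hn0 hc
  have hdisj : n * c ⊓ k • p = 0 :=
    inf_smul_eq_zero (mul_right_inf n p c (by rw [inf_comm]; exact posPart_inf_negPart_eq_zero _) hc)
      hk
  have hnc : n * c ≤ k ^ 2 • w := by
    have hk2 : 0 ≤ k ^ 2 • w := smul_nonneg (sq_nonneg k) hw
    have h1 : n * c ≤ k ^ 2 • w + k • p := by
      calc n * c ≤ (k • w) * c := IsFAlgebra.mul_le_mul_right' hnle hc
        _ = k ^ 2 • w + k • (w * c - k • w) := by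
          rw [smul_mul_assoc, smul_sub, smul_smul, ← sq]
          abel
        _ ≤ k ^ 2 • w + k • p :=
          add_le_add le_rfl (smul_le_smul_of_nonneg_left (le_posPart _) hk)
    calc n * c ≤ n * c ⊓ (k ^ 2 • w + k • p) := le_inf le_rfl h1
      _ ≤ n * c ⊓ k ^ 2 • w + n * c ⊓ k • p :=
        inf_add_le_inf_add_inf hnc0 hk2 (smul_nonneg hk hp0)
      _ ≤ k ^ 2 • w := by
        rw [hdisj, add_zero]
        exact inf_le_right
  have h2 : k • (w * c) - w * c * c ≤ n * c := by
    have h3 : p * c - n * c = w * c * c - k • (w * c) := by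
      rw [← sub_mul, hpn, sub_mul, smul_mul_assoc]
    have h4 : 0 ≤ p * c := IsFAlgebra.mul_nonneg _ _ hp0 hc
    rw [← neg_sub, ← h3, neg_sub]
    exact sub_le_self _ h4
  exact sub_le_iff_le_add.1 (h2.trans hnc)

end IsFAlgebra

/-! ### The operator `f ↦ G · f` is an orthomorphism. -/

section Arens

variable {A : Type u} [NonUnitalRing A] [Lattice A] [IsOrderedAddMonoid A] [Module ℝ A]
  [IsOrderedModule ℝ A] [IsScalarTower ℝ A A] [SMulCommClass ℝ A A] [IsFAlgebra A]

theorem dualMul_neg (f : RieszDual A) (a : A) : dualMul f (-a) = -dualMul f a := by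
  apply RieszDual.ext_fun
  intro x
  simp [neg_mul]

theorem dualMul_add_left (f g : RieszDual A) (a : A) :
    dualMul (f + g) a = dualMul f a + dualMul g a :=
  RieszDual.ext_fun fun _ => rfl

theorem dualMul_smul_left (r : ℝ) (f : RieszDual A) (a : A) :
    dualMul (r • f) a = r • dualMul f a :=
  RieszDual.ext_fun fun _ => rfl

theorem abs_dualMul_le {f : RieszDual A} (hf : 0 ≤ f) {v x : A} (h : |v| ≤ x) :
    |dualMul f v| ≤ dualMul f x := by
  refine sup_le (dualMul_mono hf ((le_abs_self v).trans h)) ?_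
  rw [← dualMul_neg]
  exact dualMul_mono hf ((neg_le_abs v).trans h)

theorem dualMul_apply_le {f : RieszDual A} (hf : 0 ≤ f) {w b c : A} (hw : 0 ≤ w) (hwb : w ≤ b)
    (hc : 0 ≤ c) {k : ℝ} (hk : 0 < k) : dualMul f w c ≤ k * f w + k⁻¹ * f (b * c * c) := by
  have h1 := RieszDual.apply_mono hf (IsFAlgebra.smul_mul_le hw hc hk.le)
  have h2 : f (w * c * c) ≤ f (b * c * c) := RieszDual.apply_mono hf
    (IsFAlgebra.mul_le_mul_right' (IsFAlgebra.mul_le_mul_right' hwb hc) hc)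
  rw [map_smul, map_add, map_smul, smul_eq_mul, smul_eq_mul] at h1
  rw [dualMul_apply, ← mul_le_mul_iff_right₀ hk, mul_add, mul_inv_cancel_left₀ hk.ne']
  linarith

/-- Order continuity requires a decreasing majorant of `|f · v n|`. The limits `s n` of `f · w n N`
as `N → ∞` serve, acting as `f` times a tail supremum of `x` that need not exist in `A`. -/
theorem tendsto_apply_dualMul {f : RieszDual A} (hf : 0 ≤ f) {b : A} {x v : ℕ → A}
    (hx : ∀ n, 0 ≤ x n) (hxb : ∀ n, x n ≤ b) (hfx : ∀ n, f (x n) ≤ (1 / 2) ^ n)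
    (hv : ∀ n, |v n| ≤ x n) {G : RieszDual (RieszDual A)} (hG : IsOrderContinuous G) :
    Tendsto (fun n => G (dualMul f (v n))) atTop (𝓝 0) := by
  have hb : 0 ≤ b := (hx 0).trans (hxb 0)
  -- The sum keeps `f (w n N)` geometrically small; the cap `b` bounds `f · w n N` by `f · b` and
  -- makes the error `k⁻¹ * f (b * c * c)` uniform.
  let w (n N : ℕ) : A := b ⊓ ∑ m ∈ Finset.Ico n N, x m
  have hw0 (n N) : 0 ≤ w n N := le_inf hb (Finset.sum_nonneg fun m _ => hx m)
  have hwb (n N) : w n N ≤ b := inf_le_left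
  have hwmono (n) : Monotone (w n) := fun N N' h => inf_le_inf_left _
    (Finset.sum_le_sum_of_subset_of_nonneg (Finset.Ico_subset_Ico le_rfl h) fun m _ _ => hx m)
  have hwanti (N) : Antitone (fun n => w n N) := fun n n' h => inf_le_inf_left _
    (Finset.sum_le_sum_of_subset_of_nonneg (Finset.Ico_subset_Ico h le_rfl) fun m _ _ => hx m)
  have hxw (n) : x n ≤ w n (n + 1) := le_inf (hxb n) (by simp)
  have hfw (n N) : f (w n N) ≤ 2 * (1 / 2) ^ n := by
    calc f (w n N) ≤ f (∑ m ∈ Finset.Ico n N, x m) := RieszDual.apply_mono hf inf_le_right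
      _ = ∑ m ∈ Finset.Ico n N, f (x m) := map_sum _ _ _
      _ ≤ ∑ m ∈ Finset.Ico n N, (1 / 2 : ℝ) ^ m := Finset.sum_le_sum fun m _ => hfx m
      _ ≤ (1 / 2 : ℝ) ^ n / (1 - 1 / 2) :=
        geom_sum_Ico_le_of_lt_one (by norm_num) (by norm_num)
      _ = 2 * (1 / 2) ^ n := by ring
  have hex (n : ℕ) := RieszDual.exists_tendsto_of_monotone (F := fun N => dualMul f (w n N))
    (fun _ _ h => dualMul_mono hf (hwmono n h)) (g := dualMul f b)
    (fun N => dualMul_mono hf (hwb n N))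
  choose s hs using hex
  have hs0 (n) : 0 ≤ s n := fun c hc => ge_of_tendsto' (hs n c) fun N => by
    have := dualMul_mono hf (hw0 n N) c hc
    simpa using this
  have hsanti : Antitone s := fun n n' h c hc =>
    le_of_tendsto_of_tendsto' (hs n' c) (hs n c) fun N => dualMul_mono hf (hwanti N h) c hc
  have hvs (n) : |dualMul f (v n)| ≤ s n := by
    refine (abs_dualMul_le hf (hv n)).trans fun c hc => ge_of_tendsto (hs n c) ?_
    filter_upwards [eventually_ge_atTop (n + 1)] with N hN
    exact dualMul_mono hf ((hxw n).trans (hwmono n hN)) c hc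
  have hsle (n : ℕ) {c : A} (hc : 0 ≤ c) {k : ℝ} (hk : 0 < k) :
      s n c ≤ k * (2 * (1 / 2) ^ n) + k⁻¹ * f (b * c * c) :=
    le_of_tendsto' (hs n c) fun N =>
      (dualMul_apply_le hf (hw0 n N) (hwb n N) hc hk).trans
        (add_le_add (mul_le_mul_of_nonneg_left (hfw n N) hk.le) le_rfl)
  have hglb : IsGLB (Set.range fun i : ULift.{u} ℕ => s i.down) 0 := by
    refine ⟨?_, fun t ht c hc => ?_⟩
    · rintro _ ⟨i, rfl⟩
      exact hs0 _
    -- First `n → ∞` with `k` fixed, then `k → ∞`.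
    have h1 (k : ℝ) (hk : 0 < k) : t c ≤ k⁻¹ * f (b * c * c) := by
      have hlim : Tendsto (fun n : ℕ => k * (2 * (1 / 2 : ℝ) ^ n) + k⁻¹ * f (b * c * c)) atTop
          (𝓝 (k * (2 * 0) + k⁻¹ * f (b * c * c))) :=
        (((tendsto_pow_atTop_nhds_zero_of_lt_one (by norm_num) (by norm_num)).const_mul
          2).const_mul k).add_const _
      rw [mul_zero, mul_zero, zero_add] at hlim
      exact ge_of_tendsto' hlim fun n => (ht ⟨⟨n⟩, rfl⟩ c hc).trans (hsle n hc hk)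
    have hlim : Tendsto (fun k : ℝ => k⁻¹ * f (b * c * c)) atTop (𝓝 (0 * f (b * c * c))) :=
      tendsto_inv_atTop_zero.mul_const _
    rw [zero_mul] at hlim
    refine ge_of_tendsto hlim ?_
    filter_upwards [eventually_gt_atTop 0] with k hk using h1 k hk
  -- The nets in `IsOrderContinuous` are indexed in universe `u`, so the sequence is lifted there.
  have hup : Tendsto (ULift.up : ℕ → ULift.{u} ℕ) atTop atTop :=
    tendsto_atTop.2 fun i => eventually_ge_atTop i.down
  exact (hG (ULift.{u} ℕ) (fun i => dualMul f (v i.down)) (fun i => s i.down)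
    (fun _ _ h => hsanti h) hglb fun i => hvs i.down).comp hup

/-- Splitting `b = x n + (b - x n)` bounds the infimum at `b` by `|G · f| (x n) + g (b - x n)`. The
first term is within `2⁻ⁿ` of some `G (f · v n)` with `|v n| ≤ x n`, so both tend to `0`. -/
theorem abs_bidualMul_inf_eq_zero {G : RieszDual (RieszDual A)} (hG : IsOrderContinuous G)
    {f g : RieszDual A} (h : f ⊓ g = 0) : |bidualMul G f| ⊓ g = 0 := by
  have hf : 0 ≤ f := h ▸ inf_le_left
  have hg : 0 ≤ g := h ▸ inf_le_right
  refine le_antisymm (fun b hb => ?_) (le_inf (abs_nonneg _) hg)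
  have hpow (n : ℕ) : (0 : ℝ) < (1 / 2) ^ n := by positivity
  have hex (n : ℕ) := RieszDual.exists_lt_of_inf_eq_zero h hb (hpow n)
  choose x hx hxb hlt using hex
  have hex' (n : ℕ) :=
    RieszDual.exists_abs_le_and_abs_apply_lt (bidualMul G f) (hx n) (hpow n)
  choose v hv hvlt using hex'
  have hfx (n) : f (x n) ≤ (1 / 2) ^ n := by
    have := hg _ (sub_nonneg.2 (hxb n))
    rw [RieszDual.zero_apply] at this
    linarith [hlt n]
  have hgx (n) : g (b - x n) ≤ (1 / 2) ^ n := by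
    have := hf _ (hx n)
    rw [RieszDual.zero_apply] at this
    linarith [hlt n]
  have hpow0 : Tendsto (fun n : ℕ => (1 / 2 : ℝ) ^ n) atTop (𝓝 0) :=
    tendsto_pow_atTop_nhds_zero_of_lt_one (by norm_num) (by norm_num)
  have hlim := ((tendsto_apply_dualMul hf hx hxb hfx hv hG).add hpow0).add hpow0
  rw [add_zero, add_zero] at hlim
  refine ge_of_tendsto' hlim fun n => ?_
  have h1 : (|bidualMul G f| ⊓ g) (x n) ≤ |bidualMul G f| (x n) :=
    (inf_le_left : |bidualMul G f| ⊓ g ≤ _) _ (hx n)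
  have h2 : (|bidualMul G f| ⊓ g) (b - x n) ≤ g (b - x n) :=
    (inf_le_right : |bidualMul G f| ⊓ g ≤ _) _ (sub_nonneg.2 (hxb n))
  rw [map_sub] at h2
  have h3 := hvlt n
  rw [bidualMul_apply] at h3
  linarith [hgx n]

/-- The operator `f ↦ G · f` on the order dual. -/
noncomputable def bidualMulLin (G : RieszDual (RieszDual A)) : RieszDual A →ₗ[ℝ] RieszDual A where
  toFun := bidualMul G
  map_add' f g := RieszDual.ext_fun fun a => by
    simp [dualMul_add_left]
  map_smul' r f := RieszDual.ext_fun fun a => by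
    simp [dualMul_smul_left]

theorem bidualMul_mono {G : RieszDual (RieszDual A)} (hG : 0 ≤ G) {f g : RieszDual A}
    (h : f ≤ g) : bidualMul G f ≤ bidualMul G g := fun a ha =>
  RieszDual.apply_mono hG fun x hx => h _ (IsFAlgebra.mul_nonneg a x ha hx)

theorem bidualMulLin_isOrthomorphism {G : RieszDual (RieszDual A)} (hG : IsOrderContinuous G) :
    IsOrthomorphism (bidualMulLin G) where
  orderBounded f g := by
    refine ⟨bidualMul G⁺ f - bidualMul G⁻ g, bidualMul G⁺ g - bidualMul G⁻ f, fun h hh => ?_⟩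
    have e : bidualMulLin G h = bidualMul G⁺ h - bidualMul G⁻ h := by
      apply RieszDual.ext_fun
      intro a
      change G _ = _
      rw [RieszDual.sub_apply, bidualMul_apply, bidualMul_apply, ← RieszDual.sub_apply,
        posPart_sub_negPart]
    rw [e]
    exact ⟨sub_le_sub (bidualMul_mono (posPart_nonneg G) hh.1)
        (bidualMul_mono (negPart_nonneg G) hh.2),
      sub_le_sub (bidualMul_mono (posPart_nonneg G) hh.2)
        (bidualMul_mono (negPart_nonneg G) hh.1)⟩
  disjoint f g hfg := by
    have h1 : |bidualMul G f⁺| ⊓ |g| = 0 := abs_bidualMul_inf_eq_zero hG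
      (inf_eq_zero_of_le hfg (posPart_nonneg f) (abs_nonneg g)
        (sup_le (le_abs_self f) (abs_nonneg f)) le_rfl)
    have h2 : |bidualMul G f⁻| ⊓ |g| = 0 := abs_bidualMul_inf_eq_zero hG
      (inf_eq_zero_of_le hfg (negPart_nonneg f) (abs_nonneg g)
        (sup_le (neg_le_abs f) (abs_nonneg f)) le_rfl)
    rw [inf_comm] at h1 h2
    unfold RieszDisjoint
    rw [inf_comm]
    refine inf_eq_zero_of_le (inf_add_eq_zero h1 h2) (abs_nonneg _) (abs_nonneg _) le_rfl ?_
    have e : bidualMulLin G f = bidualMul G f⁺ + -bidualMul G f⁻ := by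
      change _ = bidualMulLin G f⁺ + -bidualMulLin G f⁻
      rw [← sub_eq_add_neg, ← map_sub, posPart_sub_negPart]
    rw [e, ← abs_neg (bidualMul G f⁻)]
    exact abs_add_le _ _

end Arens

theorem theorem3p1 {A : Type u} [NonUnitalRing A] [Lattice A] [IsOrderedAddMonoid A]
    [Module ℝ A] [IsOrderedModule ℝ A] [IsScalarTower ℝ A A] [SMulCommClass ℝ A A]
    [IsFAlgebra A] (hA : HasSeparatingOrderDual A)
    (π : RieszDual A →ₗ[ℝ] RieszDual A) (hπ : IsOrthomorphism π) : IsFLinear π where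
  orderBounded := hπ.orderBounded
  map_bidualMul _ hG f :=
    hπ.comp_eq_comp RieszDual.isArchimedeanRiesz (bidualMulLin_isOrthomorphism hG) f
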